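/- **Setting.** A GPT consists of a finite-dimensional real vector space $V$, closed pointed convex effect cones $P^{(n)}\subseteq V^{\otimes n}$, a unit effect $\underline 1$ such that $\underline 1^{\otimes n}$ lies in the relative interior of $P^{(n)}$, and closed pointed convex state cones $D^{(n)}\subseteq (V^{\otimes n})^*$ of functionals non-negative on $P^{(n)}$, such that restriction to $\mathrm{span}\,P^{(n)}$ maps $\mathrm{span}\,D^{(n)}$ bijectively onto $(\mathrm{span}\,P^{(n)})^*$. Cones are compatible with composition: $P^{(m)}\otimes P^{(n)}\subseteq P^{(m+n)}$, $D^{(m)}\otimes D^{(n)}\subseteq D^{(m+n)}$, and contracting an element of $D^{(l+m+r)}$ with an element of $P^{(m)}$ on $m$ neighbouring subsystems gives an element of $D^{(l+r)}$. No permutation invariance is assumed. Let $\mathcal S^{(n)}=\{\sigma\in D^{(n)}:\sigma(\underline 1^{\otimes n})=1\}$, $\neg e=\underline 1^{\otimes n}-e$ and $\mathcal E^{(n)}=\{e\in P^{(n)}:\neg e\in P^{(n)}\}$. The local dimension is $\dim\mathrm{span}\,P^{(1)}$. The GPT is *locally tomographic* if, for all $n$, $\mathrm{span}\,P^{(n)}$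 is spanned by the products $e_1\otimes\dots\otimes e_n$ with $e_i\in P^{(1)}$. For $\rho\in(V\otimes V)^*$ let $\hat\rho:V\to V^*$, $e\mapsto\rho(e,\cdot)$; for $\phi\in V\otimes V$ let $\hat\phi:V^*\to V$ be the contraction of $\sigma \in V^*$ with the first leg of $\phi$. An *instance of the iterated CHSH game* consists of $\rho\in\mathcal S^{(2)}$, effects $\phi_1,\dots,\phi_n\in\mathcal E^{(2)}$ with $\sum_k\phi_k=\underline 1^{\otimes2}$, and $e_i,f_j\in\mathcal E^{(1)}$ ($i,j\in\{0,1\}$). Put $A_i=e_i-\neg e_i$, $C_j=f_j-\neg f_j$, $R_k=\hat\rho\hat\phi_k$, $R_{\vec k}=R_{k_1}\cdots R_{k_N}$ ($R_{\vec k}=\mathrm{id}$ for $N=0$), $p_{\vec k}=(R_{\vec k}\hat\rho)(\underline 1)(\underline 1)$. It *describes closed chains* if the experiment in which the two ends of a chain are brought together and measured once more has non-negative pairings: $\mathrm{tr}(R_{\vec k}\hat\rho\,\hat\phi_l)\ge0$ for all $N\ge0$, $\vec k\in[n]^N$, $l\in[n]$. It is *stable* if for every $N\ge0$ and $\vec k\in[n]^N$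 with $p_{\vec k}\ne0$ there is a relabelling of the settings and outcomes of Alice's device (one of eight), turning $A_i$ into $A_i'$, such that the bilinear form $\sigma=\frac1{p_{\vec k}}R_{\vec k}\hat\rho$ satisfies: (a) $\sum_{i,j}(-1)^{ij}\sigma(A_i',C_j)=\sum_{i,j}(-1)^{ij}\rho(A_i,C_j)$; (b) $\sigma(A_i',\underline 1)=\sigma(\underline 1,C_j)=0$ and $(-1)^{ij}\sigma(A'_i,C_j)=a$ for all $i,j$, for some $a\in(\frac12,1]$. The *teleportation semigroup* of the instance is generated by the $R_k$; that of the GPT by all $\hat\rho\hat\phi$ with $\rho\in\mathcal S^{(2)}$, $\phi\in\mathcal E^{(2)}$. The *image of the local state space* under such a semigroup is the set of all normalised states $T\sigma/(T\sigma)(\underline 1)$ with $T$ in the semigroup, $\sigma\in\mathcal S^{(1)}$, $(T\sigma)(\underline 1)\neq0$. **Lemma (GPT no-pancake theorem).** 1. If a locally tomographic GPT contains a stable instance of the iterated CHSH game that describes closed chains, then the directional vector space (of the affine hull) of the image of the local state space under the teleportation semigroup of the instance, and hence also under that of the GPT, has dimension at least three. 2. Consequently no locally tomographic GPT of local dimension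 at most three contains a stable instance that describes closed chains. 3. In particular, this holds for every locally tomographic GPT whose local systems are those of a regular $m$-gon theory, $m\ge3$ (the local state space is a regular $m$-gon, and the local effect cone consists of all affine functionals non-negative on it). 4. If, moreover, the effect cones are generated by product effects and the state cones consist of all functionals non-negative on them -- for $m=4$ this is boxworld -- then there is no stable instance at all. -/

import Mathlib

open scoped TensorProduct Topology

noncomputable section

/-- The identification `V ≃ V^{⊗1}`, `v ↦ v`. -/
def tensorOne (V : Type*) [AddCommGroup V] [Module ℝ V] : V ≃ₗ[ℝ] ⨂[ℝ]^1 V :=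
  (PiTensorProduct.subsingletonEquiv (R := ℝ) (s := fun _ : Fin 1 => V) 0).symm

/-- The identification `V ⊗ V ≃ V^{⊗2}`, `v ⊗ w ↦ v ⊗ w`. -/
def tensorTwo (V : Type*) [AddCommGroup V] [Module ℝ V] : (V ⊗[ℝ] V) ≃ₗ[ℝ] ⨂[ℝ]^2 V :=
  (TensorProduct.congr (tensorOne V) (tensorOne V)).trans
    (TensorPower.mulEquiv (R := ℝ) (M := V) (n := 1) (m := 1))

/-- The product `x ⊗ y ∈ V^{⊗(m+n)}` of `x ∈ V^{⊗m}` and `y ∈ V^{⊗n}`. -/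
def tensorMul {V : Type*} [AddCommGroup V] [Module ℝ V] {m n : ℕ} (x : ⨂[ℝ]^m V) (y : ⨂[ℝ]^n V) :
    ⨂[ℝ]^(m + n) V :=
  TensorPower.mulEquiv (R := ℝ) (M := V) (x ⊗ₜ[ℝ] y)

/-- The product functional `x ⊗ y ↦ σ x * τ y` on `V^{⊗(m+n)}`. -/
def functionalMul {V : Type*} [AddCommGroup V] [Module ℝ V] {m n : ℕ}
    (σ : Module.Dual ℝ (⨂[ℝ]^m V)) (τ : Module.Dual ℝ (⨂[ℝ]^n V)) :
    Module.Dual ℝ (⨂[ℝ]^(m + n) V) :=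
  (TensorProduct.dualDistrib ℝ (⨂[ℝ]^m V) (⨂[ℝ]^n V) (σ ⊗ₜ[ℝ] τ)) ∘ₗ
    (TensorPower.mulEquiv (R := ℝ) (M := V)).symm.toLinearMap

/-- A general probabilistic theory on the finite-dimensional real space `V`.
Effects live in the tensor powers of `V`, states are linear functionals on them.

The space `Span(P⁽ⁿ⁾)^*`, in which the state cone `D⁽ⁿ⁾` is generating, is realised inside
`(V^{⊗n})^*` as the linear span of `D⁽ⁿ⁾`: restriction to `Span(P⁽ⁿ⁾)` maps it bijectively onto the
dual. (If `Span(P⁽ⁿ⁾) = V^{⊗n}`, this says that `D⁽ⁿ⁾` spans `(V^{⊗n})^*`.)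

The last three fields are the composition rules: independent effects, respectively independent
states, can be put side by side, and measuring an effect on neighbouring subsystems of a state
leaves the remaining subsystems in a (sub-normalised) state. No invariance under permutations of
the subsystems is required. Topological notions refer to the standard topology of a
finite-dimensional real vector space, which is its module topology. -/
structure GPT (V : Type*) [AddCommGroup V] [Module ℝ V] where
  /-- the effect cones -/
  effectCone : ∀ n : ℕ, PointedCone ℝ (⨂[ℝ]^n V)
  /-- the unit effect -/
  unit : V
  /-- the state cones -/
  stateCone : ∀ n : ℕ, PointedCone ℝ (Module.Dual ℝ (⨂[ℝ]^n V))
  effect_closed : ∀ n, IsClosed[moduleTopology ℝ (⨂[ℝ]^n V)] (effectCone n : Set (⨂[ℝ]^n V))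
  effect_salient : ∀ n, ∀ x ∈ effectCone n, -x ∈ effectCone n → x = 0
  unit_mem_relint : ∀ n,
    PiTensorProduct.tprod ℝ (fun _ : Fin n => unit) ∈
      (letI := moduleTopology ℝ (⨂[ℝ]^n V)
       intrinsicInterior ℝ (effectCone n : Set (⨂[ℝ]^n V)))
  state_nonneg : ∀ n, ∀ σ ∈ stateCone n, ∀ x ∈ effectCone n, 0 ≤ σ x
  state_closed : ∀ n, IsClosed[moduleTopology ℝ (Module.Dual ℝ (⨂[ℝ]^n V))]
    (stateCone n : Set (Module.Dual ℝ (⨂[ℝ]^n V)))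
  state_salient : ∀ n, ∀ σ ∈ stateCone n, -σ ∈ stateCone n → σ = 0
  state_generating : ∀ n, Function.Bijective
    (fun σ : Submodule.span ℝ (stateCone n : Set (Module.Dual ℝ (⨂[ℝ]^n V))) =>
      (σ : Module.Dual ℝ (⨂[ℝ]^n V)).domRestrict
        (Submodule.span ℝ (effectCone n : Set (⨂[ℝ]^n V))))
  effect_mul : ∀ m n, ∀ x ∈ effectCone m, ∀ y ∈ effectCone n, tensorMul x y ∈ effectCone (m + n)
  state_mul : ∀ m n, ∀ σ ∈ stateCone m, ∀ τ ∈ stateCone n,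
    functionalMul σ τ ∈ stateCone (m + n)
  state_slice : ∀ l m r, ∀ σ ∈ stateCone (l + m + r), ∀ φ ∈ effectCone m,
    ∀ τ : Module.Dual ℝ (⨂[ℝ]^(l + r) V),
      (∀ (x : ⨂[ℝ]^l V) (y : ⨂[ℝ]^r V), τ (tensorMul x y) = σ (tensorMul (tensorMul x φ) y)) →
      τ ∈ stateCone (l + r)

/-- The map `ρ̂ : V → V^*`, `e ↦ ρ(e, ·)`, of a bipartite functional `ρ`. -/
def stateHat {V : Type*} [AddCommGroup V] [Module ℝ V] (ρ : Module.Dual ℝ (⨂[ℝ]^2 V)) :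
    V →ₗ[ℝ] Module.Dual ℝ V :=
  TensorProduct.curry (ρ ∘ₗ (tensorTwo V).toLinearMap)

/-- The map `φ̂ : V^* → V`, `σ ↦ φ(σ, ·)`, of `φ ∈ V ⊗ V`; on products, `σ ↦ σ(e) f` for
`φ = e ⊗ f`. -/
def effectHat {V : Type*} [AddCommGroup V] [Module ℝ V] (φ : ⨂[ℝ]^2 V) :
    Module.Dual ℝ V →ₗ[ℝ] V where
  toFun σ := TensorProduct.lid ℝ V (LinearMap.rTensor V σ ((tensorTwo V).symm φ))
  map_add' σ τ := by simp [LinearMap.rTensor_add]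
  map_smul' c σ := by simp [LinearMap.rTensor_smul]

/-- The pairing of the bipartite functional `B : V → V^*` with `φ ∈ V ⊗ V` in which the loop is
closed: the first leg of `φ` is contracted with the second leg of `B`, and the second leg of `φ`
with the first leg of `B`. -/
def loopPairing {V : Type*} [AddCommGroup V] [Module ℝ V] (B : V →ₗ[ℝ] Module.Dual ℝ V)
    (φ : ⨂[ℝ]^2 V) : ℝ :=
  LinearMap.trace ℝ (Module.Dual ℝ V) (B ∘ₗ effectHat φ)

namespace GPT

section

variable {V : Type*} [AddCommGroup V] [Module ℝ V] (G : GPT V)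

/-- `1^{⊗n}` -/
def unitPow (n : ℕ) : ⨂[ℝ]^n V := PiTensorProduct.tprod ℝ (fun _ : Fin n => G.unit)

/-- The state space `S⁽ⁿ⁾`. -/
def states (n : ℕ) : Set (Module.Dual ℝ (⨂[ℝ]^n V)) :=
  {σ | σ ∈ G.stateCone n ∧ σ (G.unitPow n) = 1}

/-- The effect space `E⁽ⁿ⁾ = P⁽ⁿ⁾ ∩ ¬P⁽ⁿ⁾`. -/
def effects (n : ℕ) : Set (⨂[ℝ]^n V) :=
  {x | x ∈ G.effectCone n ∧ G.unitPow n - x ∈ G.effectCone n}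

/-- The local effect cone `P⁽¹⁾` as a subset of `V`. -/
def localEffectCone : Set V := {v | tensorOne V v ∈ G.effectCone 1}

/-- The local effect space `E⁽¹⁾` as a subset of `V`. -/
def localEffects : Set V := {v | tensorOne V v ∈ G.effects 1}

/-- The local state space `S⁽¹⁾` as a subset of `V^*`. -/
def localStates : Set (Module.Dual ℝ V) :=
  {σ | σ ∘ₗ (tensorOne V).symm.toLinearMap ∈ G.states 1}

/-- The local dimension: the dimension of the space spanned by the local effects. -/
def localDim : ℕ := Module.finrank ℝ (Submodule.span ℝ G.localEffectCone)

/-- Local tomography: the product effects span the space of all effects. -/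
def LocallyTomographic : Prop :=
  ∀ n : ℕ, Submodule.span ℝ (G.effectCone n : Set (⨂[ℝ]^n V)) =
    Submodule.span ℝ {x | ∃ v : Fin n → V, (∀ i, v i ∈ G.localEffectCone) ∧
      x = PiTensorProduct.tprod ℝ v}

/-- The teleportation semigroup of the theory: all maps `(ρ̂₁ φ̂₁) ⋯ (ρ̂_N φ̂_N)` with `N ≥ 1`,
bipartite states `ρᵢ` and bipartite effects `φᵢ`. -/
def teleportationSemigroup : Subsemigroup (Module.End ℝ (Module.Dual ℝ V)) :=
  Subsemigroup.closure
    {T | ∃ ρ ∈ G.states 2, ∃ φ ∈ G.effects 2, T = stateHat ρ ∘ₗ effectHat φ}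

/-- The image of the local state space under a family of maps: all normalised states
`T σ / (T σ)(1)`, for `T` in the family and `σ` a local state on which `T` occurs with non-zero
probability `(T σ)(1)`. -/
def imageOfLocalStates (S : Set (Module.End ℝ (Module.Dual ℝ V))) : Set (Module.Dual ℝ V) :=
  {τ | ∃ T ∈ S, ∃ σ ∈ G.localStates, T σ G.unit ≠ 0 ∧ τ = (T σ G.unit)⁻¹ • T σ}

/-- The `±1`-valued observable `e - ¬e` of a two-outcome measurement `{e, ¬e}`. -/
def observable (e : V) : V := e - (G.unit - e)

/-- The CHSH value `∑ (-1)^{ij} B(Aᵢ, Cⱼ)` of a bipartite functional `B : V → V^*`. -/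
def chshValue (B : V →ₗ[ℝ] Module.Dual ℝ V) (e f : Fin 2 → V) : ℝ :=
  ∑ i : Fin 2, ∑ j : Fin 2,
    (-1 : ℝ) ^ ((i : ℕ) * (j : ℕ)) * B (G.observable (e i)) (G.observable (f j))

/-- The two self-testing conditions: uniform marginals, and four correlators of equal strength
`a ∈ (1/2, 1]` in the pattern of the standard CHSH observable. -/
def SelfTesting (B : V →ₗ[ℝ] Module.Dual ℝ V) (e f : Fin 2 → V) : Prop :=
  ∃ a : ℝ, 1 / 2 < a ∧ a ≤ 1 ∧
    (∀ i, B (G.observable (e i)) G.unit = 0) ∧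
    (∀ j, B G.unit (G.observable (f j)) = 0) ∧
    ∀ i j : Fin 2,
      (-1 : ℝ) ^ ((i : ℕ) * (j : ℕ)) * B (G.observable (e i)) (G.observable (f j)) = a

/-- Relabelling of a pair of two-outcome measurements `{e₀, ¬e₀}`, `{e₁, ¬e₁}`: a permutation `π` of
the settings, and for each setting the possible exchange of the two outcomes. The eight relabellings
form the dihedral group of order eight; applied to Alice's device, they carry the standard CHSH
observable to the eight versions of it. -/
def relabel (π : Equiv.Perm (Fin 2)) (s : Fin 2 → Bool) (e : Fin 2 → V) : Fin 2 → V :=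
  fun i => if s i then G.unit - e (π i) else e (π i)

/-- An instance of the iterated CHSH game: a bipartite state `ρ`, a bipartite measurement
`φ₁, …, φₙ`, and two two-outcome measurements each for Alice (`eᵢ, ¬eᵢ`) and for Charlie
(`fⱼ, ¬fⱼ`). -/
structure IteratedCHSH (n : ℕ) where
  ρ : Module.Dual ℝ (⨂[ℝ]^2 V)
  φ : Fin n → ⨂[ℝ]^2 V
  e : Fin 2 → V
  f : Fin 2 → V
  ρ_mem : ρ ∈ G.states 2
  φ_mem : ∀ k, φ k ∈ G.effects 2
  φ_sum : ∑ k, φ k = G.unitPow 2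
  e_mem : ∀ i, e i ∈ G.localEffects
  f_mem : ∀ j, f j ∈ G.localEffects

end

namespace IteratedCHSH

variable {V : Type*} [AddCommGroup V] [Module ℝ V] {G : GPT V} {n : ℕ} (I : G.IteratedCHSH n)

/-- The teleportation map `R_k = ρ̂ φ̂_k`. -/
def teleportMap (k : Fin n) : Module.End ℝ (Module.Dual ℝ V) :=
  stateHat I.ρ ∘ₗ effectHat (I.φ k)

/-- `R_{k₁} ⋯ R_{k_N}` for a list `(k₁, …, k_N)` of outcomes; the identity for `N = 0`. -/
def iteratedMap (ks : List (Fin n)) : Module.End ℝ (Module.Dual ℝ V) :=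
  (ks.map I.teleportMap).prod

/-- The sub-normalised bipartite state of Alice and Charlie, as a map `V → V^*`, after the Bobs
obtained the outcomes `ks`. -/
def chain (ks : List (Fin n)) : V →ₗ[ℝ] Module.Dual ℝ V :=
  I.iteratedMap ks ∘ₗ stateHat I.ρ

/-- The probability that the Bobs obtain the outcomes `ks`. -/
def prob (ks : List (Fin n)) : ℝ := I.chain ks G.unit G.unit

/-- The normalised bipartite state of Alice and Charlie conditioned on the outcomes `ks`. -/
def swappedState (ks : List (Fin n)) : V →ₗ[ℝ] Module.Dual ℝ V :=
  (I.prob ks)⁻¹ • I.chain ks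

/-- The theory also describes the experiment in which the two ends of a chain are brought together
and the measurement of the Bobs is performed once more on them: all pairings of this kind are
non-negative. -/
def DescribesClosedChains : Prop :=
  ∀ (ks : List (Fin n)) (k : Fin n), 0 ≤ loopPairing (I.chain ks) (I.φ k)

/-- The stability condition: for every number of rounds and all outcomes that can occur there is a
relabelling of Alice's device after which the CHSH value is the one without entanglement swapping
and the self-testing conditions hold. -/
def Stable : Prop :=
  ∀ ks : List (Fin n), I.prob ks ≠ 0 →
    ∃ (π : Equiv.Perm (Fin 2)) (s : Fin 2 → Bool),
      G.chshValue (I.swappedState ks) (G.relabel π s I.e) I.f =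
          G.chshValue (stateHat I.ρ) I.e I.f ∧
        G.SelfTesting (I.swappedState ks) (G.relabel π s I.e) I.f

/-- The teleportation semigroup of the instance, generated by the `R_k`. -/
def teleportationSemigroup : Subsemigroup (Module.End ℝ (Module.Dual ℝ V)) :=
  Subsemigroup.closure (Set.range I.teleportMap)

end IteratedCHSH

section

variable {V : Type*} [AddCommGroup V] [Module ℝ V] (G : GPT V)

/-- The vertices `(cos(2πk/m), sin(2πk/m), 1)` of the regular `m`-gon at height one. -/
def polygonVertex (m : ℕ) (k : Fin m) : Fin 3 → ℝ :=
  ![Real.cos (2 * Real.pi * (k : ℕ) / m), Real.sin (2 * Real.pi * (k : ℕ) / m), 1]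

/-- The local systems are those of the regular `m`-gon theory: in suitable linear coordinates
`J : ℝ³ → V` of the space spanned by the local effects, with `J (0,0,1)` the unit effect, the local
state space is the regular `m`-gon, and the local effect cone consists of all effects that are
non-negative on it. -/
def IsRegularPolygonTheory (m : ℕ) : Prop :=
  3 ≤ m ∧ ∃ J : (Fin 3 → ℝ) →ₗ[ℝ] V, Function.Injective J ∧ J ![0, 0, 1] = G.unit ∧
    G.localEffectCone = J '' {x | ∀ k : Fin m, 0 ≤ x ⬝ᵥ polygonVertex m k} ∧
    (fun (σ : Module.Dual ℝ V) (i : Fin 3) => σ (J (Pi.single i 1))) '' G.localStates =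
      convexHull ℝ (Set.range (polygonVertex m))

/-- The composites of the theory are given by the maximal tensor product of states: the effect cones
are generated by the product effects, and all functionals that are non-negative on them are allowed
as (sub-normalised) states. -/
def HasMaximalComposites : Prop :=
  (∀ n, G.effectCone n = PointedCone.hull ℝ {x | ∃ v : Fin n → V,
    (∀ i, v i ∈ G.localEffectCone) ∧ x = PiTensorProduct.tprod ℝ v}) ∧
  ∀ n (σ : Module.Dual ℝ (⨂[ℝ]^n V)),
    σ ∈ G.stateCone n ↔ ∀ x ∈ G.effectCone n, 0 ≤ σ x

/-- Boxworld: the local state space is a square, composites are maximal. -/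
def IsBoxworld : Prop :=
  G.IsRegularPolygonTheory 4 ∧ G.HasMaximalComposites

end

end GPT

end

/-! ### Tensor identifications and contractions on product tensors -/

section

variable {V : Type*} [AddCommGroup V] [Module ℝ V]

/-! Stability forces the iterated teleportation maps to act on three distinguished coordinates as
non-negative multiples `p • g`, with `g = 1 ⊕ h` and `h` in the dihedral group of signed
permutations of size two (`Stable.exists_isSignedPerm`). Suppose the image of the local states spans
a space `Y` of dimension at most three. By local tomography every `R_k` maps all of `V^*` into `Y`,
and the three coordinates are an isomorphism on `Y`. Hence the `R_k` are matrices `q_k g_k`, and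
closed chains make all their products have non-negative trace.

This is impossible (`not_forall_trace_nonneg`). The trace of `g` lies in `{3, 1, -1}`, so each
`tr(r_k³ r_l) ≥ 0` is at least its weight `q_k³ q_l`. For `l = k` and `q_k > 0` it is three times
the weight, because `g_k⁴ = 1`. Since `∑ r_l` is the projector onto the first coordinate, the traces
sum up to exactly `q_k³`, which is the sum of the weights: a contradiction.

So the linear span has dimension at least four and the affine hull at least three. The span lies in
that of the local state cone, whose dimension is bounded by the local dimension. For maximal
composites closed chains come for free, as effects are conical combinations of products. -/

theorem tensorOne_apply (v : V) :
    tensorOne V v = PiTensorProduct.tprod ℝ (fun _ : Fin 1 => v) :=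
  PiTensorProduct.subsingletonEquiv_symm_apply' _ _

theorem tensorOne_symm_tprod (v : Fin 1 → V) :
    (tensorOne V).symm (PiTensorProduct.tprod ℝ v) = v 0 :=
  PiTensorProduct.subsingletonEquiv_apply_tprod (R := ℝ) (s := fun _ : Fin 1 => V) 0 v

theorem tensorMul_tprod {m n : ℕ} (a : Fin m → V) (b : Fin n → V) :
    tensorMul (PiTensorProduct.tprod ℝ a) (PiTensorProduct.tprod ℝ b) =
      PiTensorProduct.tprod ℝ (Fin.append a b) :=
  TensorPower.tprod_mul_tprod ℝ a b

theorem mulEquiv_symm_tprod_append {m n : ℕ} (a : Fin m → V) (b : Fin n → V) :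
    (TensorPower.mulEquiv (R := ℝ) (M := V)).symm (PiTensorProduct.tprod ℝ (Fin.append a b)) =
      PiTensorProduct.tprod ℝ a ⊗ₜ[ℝ] PiTensorProduct.tprod ℝ b := by
  rw [LinearEquiv.symm_apply_eq]
  exact (tensorMul_tprod a b).symm

theorem functionalMul_tprod_append {m n : ℕ} (σ : Module.Dual ℝ (⨂[ℝ]^m V))
    (τ : Module.Dual ℝ (⨂[ℝ]^n V)) (a : Fin m → V) (b : Fin n → V) :
    functionalMul σ τ (PiTensorProduct.tprod ℝ (Fin.append a b)) =
      σ (PiTensorProduct.tprod ℝ a) * τ (PiTensorProduct.tprod ℝ b) := by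
  simp only [functionalMul, LinearMap.comp_apply, LinearEquiv.coe_coe]
  rw [mulEquiv_symm_tprod_append]
  simp

theorem tensorTwo_tmul (u v : V) :
    tensorTwo V (u ⊗ₜ[ℝ] v) = PiTensorProduct.tprod ℝ ![u, v] := by
  have h := tensorMul_tprod (fun _ : Fin 1 => u) (fun _ : Fin 1 => v)
  rw [← tensorOne_apply, ← tensorOne_apply] at h
  refine h.trans (congrArg _ ?_)
  funext i
  fin_cases i <;> rfl

theorem tensorTwo_symm_tprod (v : Fin 2 → V) :
    (tensorTwo V).symm (PiTensorProduct.tprod ℝ v) = v 0 ⊗ₜ[ℝ] v 1 := by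
  rw [LinearEquiv.symm_apply_eq, tensorTwo_tmul]
  congr 1
  funext i
  fin_cases i <;> rfl

theorem stateHat_apply (ρ : Module.Dual ℝ (⨂[ℝ]^2 V)) (u v : V) :
    stateHat ρ u v = ρ (PiTensorProduct.tprod ℝ ![u, v]) := by
  simp [stateHat, tensorTwo_tmul]

theorem effectHat_apply (φ : ⨂[ℝ]^2 V) (σ : Module.Dual ℝ V) :
    effectHat φ σ = TensorProduct.lid ℝ V (LinearMap.rTensor V σ ((tensorTwo V).symm φ)) := rfl

theorem effectHat_tprod (v : Fin 2 → V) (σ : Module.Dual ℝ V) :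
    effectHat (PiTensorProduct.tprod ℝ v) σ = σ (v 0) • v 1 := by
  simp [effectHat_apply, tensorTwo_symm_tprod]

/-- The map `effectHat` as a linear map of the bipartite effect. -/
def effectHatLinear (V : Type*) [AddCommGroup V] [Module ℝ V] :
    (⨂[ℝ]^2 V) →ₗ[ℝ] Module.Dual ℝ V →ₗ[ℝ] V where
  toFun := effectHat
  map_add' φ ψ := by ext σ; simp [effectHat_apply]
  map_smul' c φ := by ext σ; simp [effectHat_apply]

@[simp]
theorem effectHatLinear_apply (φ : ⨂[ℝ]^2 V) : effectHatLinear V φ = effectHat φ := rfl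

/-- The product of tensors as a bilinear map. -/
def tensorMulLinear (V : Type*) [AddCommGroup V] [Module ℝ V] (m n : ℕ) :
    (⨂[ℝ]^m V) →ₗ[ℝ] (⨂[ℝ]^n V) →ₗ[ℝ] ⨂[ℝ]^(m + n) V :=
  (TensorProduct.mk ℝ _ _).compr₂ (TensorPower.mulEquiv (R := ℝ) (M := V)).toLinearMap

theorem tensorMulLinear_apply {m n : ℕ} (x : ⨂[ℝ]^m V) (y : ⨂[ℝ]^n V) :
    tensorMulLinear V m n x y = tensorMul x y := rfl

namespace GPT

variable (G : GPT V)

/-- The local state cone as a subset of `V^*`. -/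
def localStateCone : Set (Module.Dual ℝ V) :=
  {σ | σ ∘ₗ (tensorOne V).symm.toLinearMap ∈ G.stateCone 1}

variable {G}

/-- Slicing with no subsystem on the left: `e` is measured on the first of two subsystems. The slice
identity is checked on product tensors. -/
theorem stateHat_mem_localStateCone {ρ : Module.Dual ℝ (⨂[ℝ]^2 V)} (hρ : ρ ∈ G.stateCone 2)
    {e : V} (he : e ∈ G.localEffectCone) : stateHat ρ e ∈ G.localStateCone := by
  refine G.state_slice 0 1 1 ρ hρ _ he _ fun x y => ?_
  -- The type is spelled with `0 + 1` so that products of tensors apply; it is definitionally the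
  -- space over `1`.
  let τ : Module.Dual ℝ (⨂[ℝ]^(0 + 1) V) :=
    (stateHat ρ e) ∘ₗ (tensorOne V).symm.toLinearMap
  let ρ' : Module.Dual ℝ (⨂[ℝ]^(0 + 1 + 1) V) := ρ
  have key : ((tensorMulLinear V 0 1).compr₂ τ) =
      ((tensorMulLinear V (0 + 1) 1).compr₂ ρ') ∘ₗ
        ((tensorMulLinear V 0 1).flip (tensorOne V e)) := by
    refine PiTensorProduct.ext (MultilinearMap.ext fun a => ?_)
    refine PiTensorProduct.ext (MultilinearMap.ext fun c => ?_)
    simp only [LinearMap.compMultilinearMap_apply, LinearMap.compr₂_apply, LinearMap.comp_apply,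
      LinearMap.flip_apply, tensorMulLinear_apply, tensorOne_apply]
    rw [tensorMul_tprod, tensorMul_tprod, tensorMul_tprod]
    have h1 : τ (PiTensorProduct.tprod ℝ (Fin.append a c)) = stateHat ρ e (c 0) :=
      congrArg (stateHat ρ e) (tensorOne_symm_tprod (Fin.append a c))
    rw [h1, stateHat_apply]
    refine congrArg ρ (congrArg _ ?_)
    funext i
    fin_cases i <;> rfl
  exact LinearMap.congr_fun (LinearMap.congr_fun key x) y

/-- Teleportation is the slice of the three-party state `σ ⊗ ρ` in which `φ` is measured on the
first two subsystems. -/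
theorem teleport_mem_localStateCone {ρ : Module.Dual ℝ (⨂[ℝ]^2 V)} (hρ : ρ ∈ G.stateCone 2)
    {φ : ⨂[ℝ]^2 V} (hφ : φ ∈ G.effectCone 2) {σ : Module.Dual ℝ V}
    (hσ : σ ∈ G.localStateCone) : stateHat ρ (effectHat φ σ) ∈ G.localStateCone := by
  have hprod := G.state_mul 1 2 _ hσ _ hρ
  refine G.state_slice 0 2 1 _ hprod φ hφ _ fun x y => ?_
  let ω : Module.Dual ℝ (⨂[ℝ]^(0 + 2 + 1) V) :=
    functionalMul (m := 1) (n := 2) (σ ∘ₗ (tensorOne V).symm.toLinearMap) ρ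
  let τ : (⨂[ℝ]^2 V) →ₗ[ℝ] Module.Dual ℝ (⨂[ℝ]^(0 + 1) V) :=
    (LinearMap.lcomp ℝ ℝ (tensorOne V).symm.toLinearMap) ∘ₗ stateHat ρ ∘ₗ
      (LinearMap.applyₗ σ) ∘ₗ effectHatLinear V
  have key : (LinearMap.applyₗ (tensorMul x y)) ∘ₗ τ =
      ω ∘ₗ ((tensorMulLinear V (0 + 2) 1).flip y) ∘ₗ (tensorMulLinear V 0 2 x) := by
    refine PiTensorProduct.ext (MultilinearMap.ext fun b => ?_)
    have key' : (tensorMulLinear V 0 1).compr₂ (τ (PiTensorProduct.tprod ℝ b)) =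
        ((tensorMulLinear V (0 + 2) 1).compr₂ ω) ∘ₗ
          ((tensorMulLinear V 0 2).flip (PiTensorProduct.tprod ℝ b)) := by
      refine PiTensorProduct.ext (MultilinearMap.ext fun a => ?_)
      refine PiTensorProduct.ext (MultilinearMap.ext fun c => ?_)
      simp only [LinearMap.compMultilinearMap_apply, LinearMap.compr₂_apply, LinearMap.comp_apply,
        LinearMap.flip_apply, tensorMulLinear_apply]
      rw [tensorMul_tprod, tensorMul_tprod, tensorMul_tprod]
      have h1 : τ (PiTensorProduct.tprod ℝ b) (PiTensorProduct.tprod ℝ (Fin.append a c)) =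
          stateHat ρ (effectHat (PiTensorProduct.tprod ℝ b) σ) (c 0) :=
        congrArg (stateHat ρ (effectHat (PiTensorProduct.tprod ℝ b) σ))
          (tensorOne_symm_tprod (Fin.append a c))
      have h2 : ω (PiTensorProduct.tprod ℝ (Fin.append (Fin.append a b) c)) =
          functionalMul (m := 1) (n := 2) (σ ∘ₗ (tensorOne V).symm.toLinearMap) ρ
            (PiTensorProduct.tprod ℝ (Fin.append (fun _ : Fin 1 => b 0) ![b 1, c 0])) := by
        refine congrArg (functionalMul (m := 1) (n := 2) _ ρ) (congrArg _ ?_)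
        funext i
        fin_cases i <;> rfl
      rw [h1, h2, functionalMul_tprod_append, effectHat_tprod, map_smul, LinearMap.smul_apply,
        stateHat_apply, LinearMap.comp_apply, LinearEquiv.coe_coe, tensorOne_symm_tprod,
        smul_eq_mul]
    exact LinearMap.congr_fun (LinearMap.congr_fun key' x) y
  exact LinearMap.congr_fun key φ

end GPT
end

/-! ### Local states, their determination by effects, and dimensions -/

namespace GPT

section

variable {V : Type*} [AddCommGroup V] [Module ℝ V] {G : GPT V}

theorem mem_localStates_iff {σ : Module.Dual ℝ V} :
    σ ∈ G.localStates ↔ σ ∈ G.localStateCone ∧ σ G.unit = 1 := by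
  have h : (σ ∘ₗ (tensorOne V).symm.toLinearMap) (G.unitPow 1) = σ G.unit :=
    congrArg σ (tensorOne_symm_tprod _)
  simp only [localStates, states, localStateCone, Set.mem_ofPred_eq, h]

theorem tensorOne_unit : tensorOne V G.unit = G.unitPow 1 := tensorOne_apply _

theorem unit_mem_localEffectCone : G.unit ∈ G.localEffectCone := by
  let := moduleTopology ℝ (⨂[ℝ]^1 V)
  change tensorOne V G.unit ∈ G.effectCone 1
  rw [tensorOne_unit]
  exact intrinsicInterior_subset (G.unit_mem_relint 1)

theorem mem_localEffects_iff {e : V} :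
    e ∈ G.localEffects ↔ e ∈ G.localEffectCone ∧ G.unit - e ∈ G.localEffectCone := by
  simp only [localEffects, effects, localEffectCone, Set.mem_ofPred_eq, map_sub, tensorOne_unit]

theorem localState_nonneg {σ : Module.Dual ℝ V} (hσ : σ ∈ G.localStateCone) {e : V}
    (he : e ∈ G.localEffectCone) : 0 ≤ σ e := by
  simpa using G.state_nonneg 1 _ hσ _ he

/-- This is the injective half of `state_generating`, transported from `V^{⊗1}` to `V`. -/
theorem localState_eq_of_eqOn {σ τ : Module.Dual ℝ V}
    (hσ : σ ∈ Submodule.span ℝ G.localStateCone) (hτ : τ ∈ Submodule.span ℝ G.localStateCone)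
    (h : ∀ e ∈ G.localEffectCone, σ e = τ e) : σ = τ := by
  have hmem : ∀ σ ∈ Submodule.span ℝ G.localStateCone, σ ∘ₗ (tensorOne V).symm.toLinearMap ∈
      Submodule.span ℝ (G.stateCone 1 : Set (Module.Dual ℝ (⨂[ℝ]^1 V))) := fun σ hσ => by
    have := Submodule.mem_map_of_mem (f := (tensorOne V).symm.toLinearMap.dualMap) hσ
    rw [Submodule.map_span] at this
    refine Submodule.span_mono ?_ this
    rintro _ ⟨τ, hτ, rfl⟩
    exact hτ
  have heq := @(G.state_generating 1).1 ⟨_, hmem σ hσ⟩ ⟨_, hmem τ hτ⟩ ?_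
  · ext v
    have := LinearMap.congr_fun (congrArg Subtype.val heq) (tensorOne V v)
    simpa using this
  · refine LinearMap.ext fun x => ?_
    have : Set.EqOn (σ ∘ₗ (tensorOne V).symm.toLinearMap) (τ ∘ₗ (tensorOne V).symm.toLinearMap)
        (G.effectCone 1) := fun x hx => by
      refine h ((tensorOne V).symm x) ?_
      simpa [localEffectCone] using hx
    exact LinearMap.eqOn_span this x.2

/-- This is the surjective half of `state_generating`: a functional can be moved into the span of
the states without changing its values on effects. -/
theorem exists_localState_eqOn (τ : Module.Dual ℝ V) :
    ∃ σ ∈ Submodule.span ℝ G.localStateCone, ∀ e ∈ G.localEffectCone, σ e = τ e := by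
  obtain ⟨⟨σ, hσ⟩, h⟩ := (G.state_generating 1).2
    ((τ ∘ₗ (tensorOne V).symm.toLinearMap).domRestrict _)
  refine ⟨σ ∘ₗ (tensorOne V).toLinearMap, ?_, fun e he => ?_⟩
  · have := Submodule.mem_map_of_mem (f := (tensorOne V).toLinearMap.dualMap) hσ
    rw [Submodule.map_span] at this
    refine Submodule.span_mono ?_ this
    rintro _ ⟨τ, hτ, rfl⟩
    change (τ ∘ₗ _) ∘ₗ _ ∈ G.stateCone 1
    rw [LinearMap.comp_assoc]
    simpa using hτ
  · simpa using LinearMap.congr_fun h ⟨tensorOne V e, Submodule.subset_span he⟩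

/-- As the unit is relatively interior, `1 + t (e - 1)` remains an effect for some `t < 0`. There
`σ` takes the value `t σ(e)`, which must be non-negative. -/
theorem localState_eq_zero {σ : Module.Dual ℝ V} (hσ : σ ∈ G.localStateCone)
    (h : σ G.unit = 0) : σ = 0 := by
  refine localState_eq_of_eqOn (Submodule.subset_span hσ) (Submodule.zero_mem _) fun e he => ?_
  refine le_antisymm ?_ (localState_nonneg hσ he)
  let : TopologicalSpace (⨂[ℝ]^1 V) := moduleTopology ℝ (⨂[ℝ]^1 V)
  have : IsModuleTopology ℝ (⨂[ℝ]^1 V) := ⟨rfl⟩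
  have := IsModuleTopology.toContinuousAdd ℝ (⨂[ℝ]^1 V)
  obtain ⟨y, hy, hyu⟩ := mem_intrinsicInterior.1 (G.unit_mem_relint 1)
  have hu : (y : ⨂[ℝ]^1 V) = tensorOne V G.unit := hyu.trans (tensorOne_apply _).symm
  have huC : tensorOne V G.unit ∈ G.effectCone 1 := unit_mem_localEffectCone
  have hline : ∀ t : ℝ, AffineMap.lineMap (tensorOne V G.unit) (tensorOne V e) t ∈
      affineSpan ℝ (G.effectCone 1 : Set (⨂[ℝ]^1 V)) := fun t =>
    AffineMap.lineMap_mem t (subset_affineSpan ℝ _ huC) (subset_affineSpan ℝ _ he)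
  let γ : ℝ → affineSpan ℝ (G.effectCone 1 : Set (⨂[ℝ]^1 V)) := fun t => ⟨_, hline t⟩
  have hcont : Continuous fun t : ℝ => (t • (tensorOne V e - tensorOne V G.unit) +
      tensorOne V G.unit : ⨂[ℝ]^1 V) := by
    fun_prop
  have hγ : Continuous γ := hcont.subtype_mk hline
  have hγ0 : γ 0 = y := Subtype.ext (by simp [γ, hu])
  have hnhds : ∀ᶠ t in 𝓝 (0 : ℝ), (γ t : ⨂[ℝ]^1 V) ∈ G.effectCone 1 := by
    have := hγ.continuousAt (x := 0)
    rw [ContinuousAt, hγ0] at this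
    exact this.eventually (mem_interior_iff_mem_nhds.1 hy)
  obtain ⟨t, ht, ht0⟩ := (hnhds.filter_mono nhdsWithin_le_nhds |>.and
    (self_mem_nhdsWithin (s := Set.Iio (0 : ℝ)))).exists
  have := G.state_nonneg 1 _ hσ _ ht
  simp [γ, AffineMap.lineMap_apply, h] at this
  exact nonpos_of_mul_nonneg_right this ht0

theorem finrank_span_localStateCone [FiniteDimensional ℝ V] :
    Module.finrank ℝ (Submodule.span ℝ G.localStateCone) ≤ G.localDim := by
  have h : Module.finrank ℝ (Module.Dual ℝ (Submodule.span ℝ G.localEffectCone)) = G.localDim :=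
    Subspace.dual_finrank_eq
  rw [← h]
  refine LinearMap.finrank_le_finrank_of_injective
    (f := (Submodule.span ℝ G.localEffectCone).dualRestrict ∘ₗ Submodule.subtype _) ?_
  intro σ τ hστ
  refine Subtype.ext (localState_eq_of_eqOn σ.2 τ.2 fun e he => ?_)
  exact LinearMap.congr_fun hστ ⟨e, Submodule.subset_span he⟩

/-- Under local tomography `φ` is a linear combination of products `e ⊗ f` of local effects, and
`σ(e) f` sees `σ` only through its values on local effects. -/
theorem LocallyTomographic.effectHat_eq (hG : G.LocallyTomographic) {φ : ⨂[ℝ]^2 V}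
    (hφ : φ ∈ G.effectCone 2) {σ τ : Module.Dual ℝ V}
    (h : ∀ e ∈ G.localEffectCone, σ e = τ e) : effectHat φ σ = effectHat φ τ := by
  have hmem := Submodule.subset_span (R := ℝ) hφ
  rw [hG 2] at hmem
  have : Set.EqOn ((effectHatLinear V).flip σ) ((effectHatLinear V).flip τ)
      {x | ∃ v : Fin 2 → V, (∀ i, v i ∈ G.localEffectCone) ∧
        x = PiTensorProduct.tprod ℝ v} := by
    rintro _ ⟨v, hv, rfl⟩
    simp [effectHat_tprod, h _ (hv 0)]
  exact LinearMap.eqOn_span this hmem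

theorem HasMaximalComposites.locallyTomographic (hG : G.HasMaximalComposites) :
    G.LocallyTomographic := by
  intro n
  rw [hG.1 n]
  exact Submodule.span_span_of_tower ..

theorem finrank_span_le_finrank_vectorSpan {W : Type*} [AddCommGroup W] [Module ℝ W]
    [FiniteDimensional ℝ W] (X : Set W) :
    Module.finrank ℝ (Submodule.span ℝ X) ≤ Module.finrank ℝ (vectorSpan ℝ X) + 1 := by
  rcases X.eq_empty_or_nonempty with rfl | ⟨x, hx⟩
  · rw [Submodule.span_empty, finrank_bot]
    exact Nat.zero_le _
  have hle : Submodule.span ℝ X ≤ vectorSpan ℝ X ⊔ Submodule.span ℝ {x} := by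
    refine Submodule.span_le.2 fun y hy => ?_
    have := Submodule.add_mem_sup (vsub_mem_vectorSpan ℝ hy hx)
      (Submodule.mem_span_singleton_self (R := ℝ) x)
    simpa using this
  calc _ ≤ _ := Submodule.finrank_mono hle
    _ ≤ _ := Submodule.finrank_add_le_finrank_add_finrank _ _
    _ ≤ _ := by gcongr; simpa using finrank_span_le_card (R := ℝ) {x}

end

end GPT

/-! ### The dihedral group and the trace contradiction -/

/-- The `3 × 3` matrices `1 ⊕ h` with `h` a signed permutation matrix of size two. -/
def IsSignedPerm (g : Matrix (Fin 3) (Fin 3) ℝ) : Prop :=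
  ∃ a b : ℝ, (a = 1 ∨ a = -1) ∧ (b = 1 ∨ b = -1) ∧
    (g = !![1, 0, 0; 0, a, 0; 0, 0, b] ∨ g = !![1, 0, 0; 0, 0, a; 0, b, 0])

namespace IsSignedPerm

variable {g h : Matrix (Fin 3) (Fin 3) ℝ}

theorem mul (hg : IsSignedPerm g) (hh : IsSignedPerm h) : IsSignedPerm (g * h) := by
  obtain ⟨a, b, ha, hb, hg⟩ := hg
  obtain ⟨c, d, hc, hd, hh⟩ := hh
  have hs : ∀ {x y : ℝ}, (x = 1 ∨ x = -1) → (y = 1 ∨ y = -1) → (x * y = 1 ∨ x * y = -1) := by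
    rintro x y (rfl | rfl) (rfl | rfl) <;> norm_num
  rcases hg with rfl | rfl <;> rcases hh with rfl | rfl
  · exact ⟨a * c, b * d, hs ha hc, hs hb hd, Or.inl (by simp)⟩
  · exact ⟨a * c, b * d, hs ha hc, hs hb hd, Or.inr (by simp)⟩
  · exact ⟨a * d, b * c, hs ha hd, hs hb hc, Or.inr (by simp)⟩
  · exact ⟨a * d, b * c, hs ha hd, hs hb hc, Or.inl (by simp)⟩

theorem exists_mul_eq_one (hg : IsSignedPerm g) :
    ∃ h, IsSignedPerm h ∧ g * h = 1 := by
  obtain ⟨a, b, ha, hb, hg⟩ := hg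
  have hs : ∀ {x : ℝ}, (x = 1 ∨ x = -1) → x * x = 1 := by
    rintro x (rfl | rfl) <;> norm_num
  rcases hg with rfl | rfl
  · exact ⟨_, ⟨a, b, ha, hb, Or.inl rfl⟩, by simp [hs ha, hs hb, Matrix.one_fin_three]⟩
  · exact ⟨_, ⟨b, a, hb, ha, Or.inr rfl⟩, by simp [hs ha, hs hb, Matrix.one_fin_three]⟩

/-- The dihedral group of order eight has exponent four. -/
theorem pow_four (hg : IsSignedPerm g) : g ^ 4 = 1 := by
  obtain ⟨a, b, ha, hb, hg⟩ := hg
  rcases ha with rfl | rfl <;> rcases hb with rfl | rfl <;> rcases hg with rfl | rfl <;>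
    simp [pow_succ, Matrix.one_fin_three]

theorem apply_zero_zero (hg : IsSignedPerm g) : g 0 0 = 1 := by
  obtain ⟨a, b, ha, hb, hg⟩ := hg
  rcases hg with rfl | rfl <;> rfl

/-- The only possible traces are `3`, `1` and `-1`. This gap turns non-negativity into a
quantitative bound. -/
theorem one_le_trace (hg : IsSignedPerm g) (h : 0 ≤ g.trace) : 1 ≤ g.trace := by
  obtain ⟨a, b, ha, hb, hg⟩ := hg
  rcases ha with rfl | rfl <;> rcases hb with rfl | rfl <;> rcases hg with rfl | rfl <;>
    simp [Matrix.trace_fin_three] at h ⊢ <;> norm_num at h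

end IsSignedPerm

/-- The sum over `l` of `tr(r_k³ r_l)` is computed in two ways: from the sum of the `r_l` it equals
`q_k³`, while the trace gap and the return to the identity at `l = k` make it strictly larger. -/
theorem not_forall_trace_nonneg {κ : Type*} [Fintype κ] (r : κ → Matrix (Fin 3) (Fin 3) ℝ)
    (hr : ∀ ks : List κ, ks ≠ [] →
      ∃ q : ℝ, 0 ≤ q ∧ ∃ g, IsSignedPerm g ∧ (ks.map r).prod = q • g)
    (hsum : ∑ k, r k = Matrix.single 0 0 1) :
    ¬ ∀ ks : List κ, ks ≠ [] → 0 ≤ (ks.map r).prod.trace := by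
  intro htr
  choose q hq g hg hrg using fun k => by simpa using hr [k] (by simp)
  have hqsum : ∑ k, q k = 1 := by
    have := congrFun (congrFun hsum 0) 0
    simpa [Matrix.sum_apply, hrg, (hg _).apply_zero_zero] using this
  obtain ⟨k, hk⟩ : ∃ k, 0 < q k := by
    by_contra! h
    linarith [Finset.sum_nonpos fun k (_ : k ∈ Finset.univ) => h k]
  have hterm : ∀ l, q k ^ 3 * q l ≤ (r k ^ 3 * r l).trace := by
    intro l
    have h1 : ([k, k, k, l].map r).prod = r k ^ 3 * r l := by
      simp [pow_succ, mul_assoc]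
    obtain ⟨p, hp, h, hh, hph⟩ := hr [k, k, k, l] (by simp)
    have ht := htr [k, k, k, l] (by simp)
    rw [h1] at hph ht
    -- The `(0, 0)` entry of a signed permutation is `1`, so it reads off the weight, which is
    -- therefore multiplicative.
    have hpq : p = q k ^ 3 * q l := by
      have := congrFun (congrFun hph 0) 0
      have hg3 : IsSignedPerm (g k ^ 3 * g l) := by
        simpa [pow_succ] using (((hg k).mul (hg k)).mul (hg k)).mul (hg l)
      simpa [hrg, smul_pow, smul_smul, hg3.apply_zero_zero, hh.apply_zero_zero, mul_comm] using
        this.symm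
    rw [hph, Matrix.trace_smul, smul_eq_mul] at ht ⊢
    rw [← hpq]
    rcases hp.eq_or_lt with rfl | hp
    · simp
    · have := hh.one_le_trace (nonneg_of_mul_nonneg_right ht hp)
      nlinarith
  have hkk : (r k ^ 3 * r k).trace = q k ^ 3 * q k * 3 := by
    rw [← pow_succ, hrg, smul_pow, (hg k).pow_four, Matrix.trace_smul, Matrix.trace_one]
    simp [pow_succ]
  -- The inequality is strict because the term `l = k` is `3 q_k⁴` instead of `q_k⁴`.
  have hle : ∑ l, (q k ^ 3 * q l) < ∑ l, (r k ^ 3 * r l).trace := by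
    refine Finset.sum_lt_sum (fun l _ => hterm l) ⟨k, Finset.mem_univ k, ?_⟩
    rw [hkk]
    nlinarith [pow_pos hk 4]
  rw [← Finset.mul_sum, hqsum, ← Matrix.trace_sum, ← Matrix.mul_sum, hsum] at hle
  have hg3 : IsSignedPerm (g k ^ 3) := by
    simpa [pow_succ] using (((hg k).mul (hg k)).mul (hg k))
  rw [hrg, smul_pow] at hle
  have : (g k ^ 3 * Matrix.single 0 0 1 : Matrix (Fin 3) (Fin 3) ℝ).trace = 1 := by
    rw [Matrix.trace_mul_single]
    simp [hg3.apply_zero_zero]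
  simp [this] at hle

/-- Linear-algebraic core: operators whose matrix coefficients between two triples are multiples of
signed permutations, whose ranges lie in a space of dimension three and which sum up to a projector
of rank one, cannot all have products of non-negative trace. -/
theorem not_forall_trace_nonneg_of_finrank_le {κ X : Type*} [Fintype κ] [AddCommGroup X]
    [Module ℝ X] [FiniteDimensional ℝ X] (R : κ → Module.End ℝ X) (Y : Submodule ℝ X)
    (hY : Module.finrank ℝ Y ≤ 3) (hRY : ∀ k x, R k x ∈ Y)
    (E : X →ₗ[ℝ] (Fin 3 → ℝ)) (F : (Fin 3 → ℝ) →ₗ[ℝ] X)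
    (hEF : ∀ ks : List κ, ∃ p : ℝ, 0 ≤ p ∧ ∃ g, IsSignedPerm g ∧
      E ∘ₗ (ks.map R).prod ∘ₗ F = p • Matrix.toLin' g)
    (l : κ) (hl : E ∘ₗ R l ∘ₗ F ≠ 0)
    (hsum : ∀ x, ∑ k, E (R k x) = Pi.single 0 (E x 0)) :
    ¬ ∀ ks : List κ, ks ≠ [] → 0 ≤ LinearMap.trace ℝ X (ks.map R).prod := by
  obtain ⟨p, hp, g, hg, hpg⟩ := hEF [l]
  have hl1 : ([l].map R).prod = R l := by simp
  rw [hl1] at hpg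
  have hp0 : p ≠ 0 := by
    rintro rfl
    exact hl (by simpa using hpg)
  obtain ⟨h, hh, hgh⟩ := hg.exists_mul_eq_one
  -- The range of `F` need not lie in `Y`, but that of `R l ∘ F` does. Undoing `p • g` makes this a
  -- section of `E`, whose range is all of `Y` by dimension.
  let S : (Fin 3 → ℝ) →ₗ[ℝ] X := p⁻¹ • (R l ∘ₗ F ∘ₗ Matrix.toLin' h)
  have hES : E ∘ₗ S = LinearMap.id := by
    have : E ∘ₗ S = p⁻¹ • ((E ∘ₗ R l ∘ₗ F) ∘ₗ Matrix.toLin' h) := by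
      exact LinearMap.ext fun v => by simp [S]
    rw [this, hpg, LinearMap.smul_comp, ← Matrix.toLin'_mul, hgh, smul_smul, inv_mul_cancel₀ hp0]
    simp
  have hSinj : Function.Injective S := by
    refine Function.LeftInverse.injective (g := E) fun v => ?_
    exact LinearMap.congr_fun hES v
  have hrange : LinearMap.range S = Y := by
    refine Submodule.eq_of_le_of_finrank_le ?_ ?_
    · rintro _ ⟨v, rfl⟩
      exact Y.smul_mem _ (hRY _ _)
    · rw [LinearMap.finrank_range_of_inj hSinj]
      simpa using hY
  have hSE : ∀ y ∈ Y, S (E y) = y := by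
    rw [← hrange]
    rintro _ ⟨v, rfl⟩
    exact congrArg S (LinearMap.congr_fun hES v)
  have hprodY : ∀ ks : List κ, ks ≠ [] → ∀ x, (ks.map R).prod x ∈ Y := by
    intro ks hks x
    obtain ⟨k, ks, rfl⟩ := List.exists_cons_of_ne_nil hks
    simpa using hRY k _
  let r : κ → Matrix (Fin 3) (Fin 3) ℝ := fun k => LinearMap.toMatrix' (E ∘ₗ R k ∘ₗ S)
  -- Compression by `E` and `S` is multiplicative, because `S ∘ E` is the identity on `Y`, where
  -- non-empty products take their values. For the empty product `E ∘ S = id` is used instead.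
  have hprod : ∀ ks : List κ,
      (ks.map r).prod = LinearMap.toMatrix' (E ∘ₗ (ks.map R).prod ∘ₗ S) := by
    intro ks
    induction ks with
    | nil =>
      have : E ∘ₗ (1 : Module.End ℝ X) ∘ₗ S = LinearMap.id := hES
      simp [this]
    | cons k ks ih =>
      simp only [List.map_cons, List.prod_cons, ih, r]
      rw [← LinearMap.toMatrix'_comp]
      congr 1
      rcases eq_or_ne ks [] with rfl | hks
      · refine LinearMap.ext fun v => ?_
        exact congrArg (fun w => E (R k (S w))) (LinearMap.congr_fun hES v)
      · refine LinearMap.ext fun v => ?_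
        simp only [LinearMap.comp_apply, Module.End.mul_apply]
        rw [hSE _ (hprodY ks hks _)]
  intro htr
  refine not_forall_trace_nonneg r ?_ ?_ ?_
  · intro ks hks
    -- The extra letter `l` accounts for the factor `R l` inside `S`.
    obtain ⟨q, hq, g', hg', hqg⟩ := hEF (ks ++ [l])
    refine ⟨p⁻¹ * q, by positivity, g' * h, hg'.mul hh, ?_⟩
    rw [hprod]
    have : E ∘ₗ (ks.map R).prod ∘ₗ S =
        p⁻¹ • ((E ∘ₗ ((ks ++ [l]).map R).prod ∘ₗ F) ∘ₗ Matrix.toLin' h) := by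
      refine LinearMap.ext fun v => ?_
      simp [S]
    rw [this, hqg, LinearMap.smul_comp, ← Matrix.toLin'_mul, smul_smul, map_smul,
      LinearMap.toMatrix'_toLin']
  · have : ∑ k, r k = LinearMap.toMatrix' (∑ k, E ∘ₗ R k ∘ₗ S) := by simp [r, map_sum]
    rw [this]
    ext i j
    rw [LinearMap.toMatrix'_apply]
    have h2 : E (S (Pi.single j 1)) = Pi.single j 1 := LinearMap.congr_fun hES _
    simp only [LinearMap.sum_apply, LinearMap.comp_apply]
    rw [hsum, h2]
    fin_cases i <;> fin_cases j <;> simp [Matrix.single]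
  · intro ks hks
    -- The product factors through `Y`, so its trace on `X` is, by cyclicity, that of its `3 × 3`
    -- compression.
    have h1 : (ks.map R).prod = S ∘ₗ (E ∘ₗ (ks.map R).prod) :=
      LinearMap.ext fun x => (hSE _ (hprodY ks hks x)).symm
    have h2 := htr ks hks
    rw [h1, LinearMap.trace_comp_comm', LinearMap.comp_assoc] at h2
    rwa [hprod, ← LinearMap.toMatrix_eq_toMatrix', ← LinearMap.trace_eq_matrix_trace]

/-! ### From self-testing correlations to signed permutations -/

namespace GPT

section

variable {V : Type*} [AddCommGroup V] [Module ℝ V]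

/-- The coordinates `τ(u)`, `(τ(C₀) + τ(C₁)) / 2a`, `(τ(C₀) - τ(C₁)) / 2a` of a functional. -/
noncomputable def chshCoordinates (u : V) (C : Fin 2 → V) (a : ℝ) :
    Module.Dual ℝ V →ₗ[ℝ] (Fin 3 → ℝ) :=
  LinearMap.pi ![Module.Dual.eval ℝ V u, Module.Dual.eval ℝ V ((2 * a)⁻¹ • (C 0 + C 1)),
    Module.Dual.eval ℝ V ((2 * a)⁻¹ • (C 0 - C 1))]

/-- The coordinates send the rows `(a, a)` and `(a, -a)` of the standard correlation table to the
two unit vectors, so a relabelled table becomes a signed permutation. The vanishing marginals split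
off the unit. -/
theorem exists_isSignedPerm (B : V →ₗ[ℝ] Module.Dual ℝ V) (u : V) (A C : Fin 2 → V) {a : ℝ}
    (ha : a ≠ 0) (π : Equiv.Perm (Fin 2)) (c : Fin 2 → ℝ) (hc : ∀ i, c i = 1 ∨ c i = -1)
    (hA : ∀ i, B (A i) u = 0) (hC : ∀ j, B u (C j) = 0)
    (hAC : ∀ i j : Fin 2, B (A (π i)) (C j) = (-1 : ℝ) ^ ((i : ℕ) * (j : ℕ)) * (B u u * c i * a)) :
    ∃ g, IsSignedPerm g ∧
      chshCoordinates u C a ∘ₗ B ∘ₗ Fintype.linearCombination ℝ ![u, A 0, A 1] =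
        B u u • Matrix.toLin' g := by
  have hπ : π = 1 ∨ π = Equiv.swap 0 1 := by
    clear hAC
    revert π
    decide
  have h00 := hAC 0 0
  have h01 := hAC 0 1
  have h10 := hAC 1 0
  have h11 := hAC 1 1
  rcases hπ with rfl | rfl
  · simp at h00 h01 h10 h11
    refine ⟨_, ⟨c 0, c 1, hc 0, hc 1, Or.inl rfl⟩, LinearMap.pi_ext' fun j => ?_⟩
    refine LinearMap.ext_ring (funext fun i => ?_)
    fin_cases i <;> fin_cases j <;>
      simp [chshCoordinates, Matrix.toLin'_apply, hA, hC, h00, h01, h10, h11,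
        Fintype.linearCombination_apply_single] <;> field_simp <;> ring
  · simp at h00 h01 h10 h11
    refine ⟨_, ⟨c 0, c 1, hc 0, hc 1, Or.inr rfl⟩, LinearMap.pi_ext' fun j => ?_⟩
    refine LinearMap.ext_ring (funext fun i => ?_)
    fin_cases i <;> fin_cases j <;>
      simp [chshCoordinates, Matrix.toLin'_apply, hA, hC, h00, h01, h10, h11,
        Fintype.linearCombination_apply_single] <;> field_simp <;> ring

end

/-! ### Chains of teleportations -/

namespace IteratedCHSH

variable {V : Type*} [AddCommGroup V] [Module ℝ V] {G : GPT V} {n : ℕ} {I : G.IteratedCHSH n}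

theorem iteratedMap_mem {σ : Module.Dual ℝ V} (hσ : σ ∈ G.localStateCone) (ks : List (Fin n)) :
    I.iteratedMap ks σ ∈ G.localStateCone := by
  induction ks with
  | nil => simpa [iteratedMap] using hσ
  | cons k ks ih =>
    have : I.iteratedMap (k :: ks) σ = I.teleportMap k (I.iteratedMap ks σ) := by
      simp [iteratedMap]
    rw [this]
    exact teleport_mem_localStateCone I.ρ_mem.1 (I.φ_mem k).1 ih

theorem chain_mem {e : V} (he : e ∈ G.localEffectCone) (ks : List (Fin n)) :
    I.chain ks e ∈ G.localStateCone :=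
  iteratedMap_mem (stateHat_mem_localStateCone I.ρ_mem.1 he) ks

theorem prob_nonneg (ks : List (Fin n)) : 0 ≤ I.prob ks :=
  localState_nonneg (chain_mem unit_mem_localEffectCone ks) unit_mem_localEffectCone

/-- Both `e` and `¬e` yield subnormalised states whose norms add up to the probability of `ks`,
hence both norms vanish. -/
theorem chain_apply_eq_zero {ks : List (Fin n)} (h : I.prob ks = 0) {e : V}
    (he : e ∈ G.localEffects) : I.chain ks e = 0 := by
  obtain ⟨h1, h2⟩ := mem_localEffects_iff.1 he
  have hp := localState_nonneg (I.chain_mem h1 ks) unit_mem_localEffectCone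
  have hn := localState_nonneg (I.chain_mem h2 ks) unit_mem_localEffectCone
  refine localState_eq_zero (chain_mem h1 ks) (le_antisymm ?_ hp)
  rw [prob] at h
  simpa [h] using hn

theorem stateHat_unit_unit : stateHat I.ρ G.unit G.unit = 1 := by
  rw [stateHat_apply, ← I.ρ_mem.2, unitPow]
  refine congrArg I.ρ (congrArg _ ?_)
  funext i
  fin_cases i <;> rfl

/-- The effects `φ_k` sum up to `1 ⊗ 1`, whose contraction is `σ ↦ σ(1) 1`: without knowledge of the
outcome nothing is teleported. -/
theorem sum_teleportMap (σ : Module.Dual ℝ V) :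
    ∑ k, I.teleportMap k σ = σ G.unit • stateHat I.ρ G.unit := by
  simp only [teleportMap, LinearMap.comp_apply]
  rw [← map_sum, ← map_smul]
  congr 1
  simp only [← effectHatLinear_apply]
  rw [← LinearMap.sum_apply, ← map_sum, I.φ_sum, effectHatLinear_apply, unitPow, effectHat_tprod]

theorem exists_prob_ne_zero : ∃ k, I.prob [k] ≠ 0 := by
  by_contra! h
  have h1 := LinearMap.congr_fun (I.sum_teleportMap (stateHat I.ρ G.unit)) G.unit
  have h2 : ∀ k, I.teleportMap k (stateHat I.ρ G.unit) G.unit = I.prob [k] := fun k => by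
    simp [prob, chain, iteratedMap]
  simp [h2, h, stateHat_unit_unit] at h1

theorem observable_relabel (π : Equiv.Perm (Fin 2)) (s : Fin 2 → Bool) (e : Fin 2 → V) (i : Fin 2) :
    G.observable (G.relabel π s e i) = (if s i then -1 else 1 : ℝ) • G.observable (e (π i)) := by
  unfold relabel observable
  split_ifs <;> simp

theorem Stable.exists_isSignedPerm (hI : I.Stable) :
    ∃ a : ℝ, a ≠ 0 ∧ ∀ ks, I.prob ks ≠ 0 → (∀ j, I.chain ks G.unit (G.observable (I.f j)) = 0) ∧
      ∃ g, IsSignedPerm g ∧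
        chshCoordinates G.unit (fun j => G.observable (I.f j)) a ∘ₗ I.chain ks ∘ₗ
          Fintype.linearCombination ℝ
            ![G.unit, G.observable (I.e 0), G.observable (I.e 1)] =
          I.prob ks • Matrix.toLin' g := by
  -- The correlator strength is a quarter of the CHSH value, and that value is preserved. So one
  -- `a`, hence one coordinate map, serves all chains.
  have hval : ∀ ks, I.prob ks ≠ 0 → ∃ (π : Equiv.Perm (Fin 2)) (s : Fin 2 → Bool) (b : ℝ),
      1 / 2 < b ∧ b = G.chshValue (stateHat I.ρ) I.e I.f / 4 ∧
      (∀ i, I.swappedState ks (G.observable (G.relabel π s I.e i)) G.unit = 0) ∧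
      (∀ j, I.swappedState ks G.unit (G.observable (I.f j)) = 0) ∧
      ∀ i j : Fin 2, (-1 : ℝ) ^ ((i : ℕ) * (j : ℕ)) *
        I.swappedState ks (G.observable (G.relabel π s I.e i)) (G.observable (I.f j)) = b := by
    intro ks hks
    obtain ⟨π, s, hchsh, b, hb, -, hA, hC, hAC⟩ := hI ks hks
    refine ⟨π, s, b, hb, ?_, hA, hC, hAC⟩
    rw [← hchsh, chshValue]
    simp only [hAC]
    simp
    ring
  have h0 : I.prob [] ≠ 0 := by
    have : I.prob [] = 1 := by simp [prob, chain, iteratedMap, stateHat_unit_unit]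
    simp [this]
  obtain ⟨-, -, a, ha, haeq, -⟩ := hval [] h0
  refine ⟨a, by linarith, fun ks hks => ?_⟩
  obtain ⟨π, s, b, -, hbeq, hA, hC, hAC⟩ := hval ks hks
  obtain rfl : b = a := hbeq.trans haeq.symm
  have hc : ∀ i, (if s i then -1 else 1 : ℝ) = 1 ∨ (if s i then -1 else 1 : ℝ) = -1 := fun i => by
    split_ifs <;> simp
  have hc2 : ∀ i, (if s i then -1 else 1 : ℝ) * (if s i then -1 else 1 : ℝ) = 1 := fun i => by
    split_ifs <;> simp
  have hc0 : ∀ i, (if s i then -1 else 1 : ℝ) ≠ 0 := fun i => by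
    split_ifs <;> simp
  generalize hcdef : (fun i => (if s i then -1 else 1 : ℝ)) = c at *
  have hcd : ∀ i, (if s i then -1 else 1 : ℝ) = c i := fun i => congrFun hcdef i
  simp only [observable_relabel, hcd, map_smul, swappedState, LinearMap.smul_apply,
    smul_eq_mul] at hA hC hAC hc hc2 hc0
  have hC' : ∀ j, I.chain ks G.unit (G.observable (I.f j)) = 0 := fun j => by
    simpa [hks] using hC j
  refine ⟨hC', GPT.exists_isSignedPerm (I.chain ks) G.unit (fun i => G.observable (I.e i))
    (fun j => G.observable (I.f j)) (by linarith) π c hc (fun i => ?_) hC' (fun i j => ?_)⟩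
  -- Relabelling only permutes the observables and changes signs, so the vanishing marginals carry
  -- over to the original ones.
  · have := hA (π.symm i)
    rw [Equiv.apply_symm_apply] at this
    simpa [hks, hc0] using this
  · rw [← hAC i j]
    have h1 : ((-1 : ℝ) ^ ((i : ℕ) * (j : ℕ))) * (-1 : ℝ) ^ ((i : ℕ) * (j : ℕ)) = 1 := by
      rw [← mul_pow]; simp
    have h2 : I.chain ks G.unit G.unit * (I.prob ks)⁻¹ = 1 := mul_inv_cancel₀ hks
    have h3 : ∀ x y z w v : ℝ, x * (y * z * (x * (z * (w * v)))) = x * x * (y * w) * (z * z) * v :=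
      fun x y z w v => by ring
    rw [h3, h1, h2, hc2 i]
    simp

/-- A state with nonzero image is rescaled twice, before and after applying `T`; if `(T σ)(1) = 0`,
then `T σ = 0` already. -/
theorem mem_span_image {S : Set (Module.End ℝ (Module.Dual ℝ V))}
    {T : Module.End ℝ (Module.Dual ℝ V)} (hT : T ∈ S)
    (hTD : ∀ σ ∈ G.localStateCone, T σ ∈ G.localStateCone) {σ : Module.Dual ℝ V}
    (hσ : σ ∈ G.localStateCone) : T σ ∈ Submodule.span ℝ (G.imageOfLocalStates S) := by
  by_cases h : T σ G.unit = 0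
  · rw [localState_eq_zero (hTD σ hσ) h]
    exact Submodule.zero_mem _
  have hσ0 : σ G.unit ≠ 0 := fun h0 => h (by simp [localState_eq_zero hσ h0])
  have hmem : (σ G.unit)⁻¹ • σ ∈ G.localStates := by
    refine mem_localStates_iff.2 ⟨?_, by simp [hσ0]⟩
    exact (G.stateCone 1).smul_mem
      (inv_nonneg.2 (localState_nonneg hσ unit_mem_localEffectCone)) hσ
  have himage : (T σ G.unit)⁻¹ • T σ ∈ G.imageOfLocalStates S := by
    refine ⟨T, hT, _, hmem, by simp [h, hσ0], ?_⟩
    simp [smul_smul, hσ0]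
  have := Submodule.smul_mem _ (T σ G.unit) (Submodule.subset_span (R := ℝ) himage)
  rwa [smul_smul, mul_inv_cancel₀ h, one_smul] at this

/-- Local tomography allows an arbitrary functional to be replaced by one in the span of the states.
This confines the range of `R_k` on all of `V^*`, as needed to evaluate traces over `V^*`. -/
theorem teleportMap_mem_span_image (hG : G.LocallyTomographic) (k : Fin n)
    (τ : Module.Dual ℝ V) :
    I.teleportMap k τ ∈
      Submodule.span ℝ (G.imageOfLocalStates I.teleportationSemigroup) := by
  obtain ⟨σ, hσ, h⟩ := exists_localState_eqOn (G := G) τ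
  have hστ : I.teleportMap k τ = I.teleportMap k σ :=
    congrArg (stateHat I.ρ) (hG.effectHat_eq (I.φ_mem k).1 fun e he => (h e he).symm)
  rw [hστ]
  refine (Submodule.span_le.2 fun σ hσ => ?_ : Submodule.span ℝ G.localStateCone ≤
    (Submodule.span ℝ (G.imageOfLocalStates I.teleportationSemigroup)).comap
      (I.teleportMap k)) hσ
  have hk : I.teleportMap k ∈ (I.teleportationSemigroup : Set (Module.End ℝ (Module.Dual ℝ V))) :=
    Subsemigroup.subset_closure ⟨k, rfl⟩
  exact mem_span_image hk
    (fun σ hσ => teleport_mem_localStateCone I.ρ_mem.1 (I.φ_mem k).1 hσ) hσ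

theorem Stable.four_le_finrank [FiniteDimensional ℝ V] (hI : I.Stable)
    (hG : G.LocallyTomographic) (hc : I.DescribesClosedChains) :
    4 ≤ Module.finrank ℝ
      (Submodule.span ℝ (G.imageOfLocalStates I.teleportationSemigroup)) := by
  by_contra! hlt
  obtain ⟨a, ha, h⟩ := hI.exists_isSignedPerm
  obtain ⟨l, hl⟩ := I.exists_prob_ne_zero
  have hzero : ∀ τ : Module.Dual ℝ V, chshCoordinates G.unit (fun j => G.observable (I.f j)) a τ 0 =
      τ G.unit := fun τ => rfl
  refine not_forall_trace_nonneg_of_finrank_le I.teleportMap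
    (Submodule.span ℝ (G.imageOfLocalStates I.teleportationSemigroup)) (by omega)
    (teleportMap_mem_span_image hG)
    (chshCoordinates G.unit (fun j => G.observable (I.f j)) a)
    (stateHat I.ρ ∘ₗ Fintype.linearCombination ℝ
      ![G.unit, G.observable (I.e 0), G.observable (I.e 1)]) (fun ks => ?_) l ?_ (fun τ => ?_)
    fun ks hks => ?_
  · refine ⟨I.prob ks, I.prob_nonneg ks, ?_⟩
    -- Chains of probability zero vanish on the unit and on Alice's observables; their weight is
    -- zero, so any signed permutation will do.
    by_cases hp : I.prob ks = 0
    · have hA : ∀ i, I.chain ks (G.observable (I.e i)) = 0 := fun i => by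
        rw [observable, map_sub, chain_apply_eq_zero hp (I.e_mem i), map_sub,
          chain_apply_eq_zero hp (I.e_mem i),
          localState_eq_zero (chain_mem unit_mem_localEffectCone ks) hp]
        simp
      have hu := localState_eq_zero (I.chain_mem unit_mem_localEffectCone ks) hp
      refine ⟨1, ⟨1, 1, Or.inl rfl, Or.inl rfl, Or.inl Matrix.one_fin_three⟩, ?_⟩
      have hB : I.chain ks ∘ₗ Fintype.linearCombination ℝ
          ![G.unit, G.observable (I.e 0), G.observable (I.e 1)] = 0 := by
        refine LinearMap.ext fun v => ?_
        simp [Fintype.linearCombination_apply, Fin.sum_univ_three, hA, hu]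
      rw [hp, zero_smul]
      exact (congrArg (fun B => chshCoordinates G.unit (fun j => G.observable (I.f j)) a ∘ₗ B)
        hB).trans (LinearMap.comp_zero _)
    · exact (h ks hp).2
  · intro h0
    refine hl ?_
    have := congrFun (LinearMap.congr_fun h0 (Pi.single 0 1)) 0
    simpa [hzero, prob, chain, iteratedMap, Fintype.linearCombination_apply_single] using this
  · have h0 : I.prob [] = 1 := by simp [prob, chain, iteratedMap, stateHat_unit_unit]
    have hC := (h [] (by simp [h0])).1
    have hC' : ∀ j, stateHat I.ρ G.unit (G.observable (I.f j)) = 0 := fun j => by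
      simpa [chain, iteratedMap] using hC j
    rw [← map_sum, sum_teleportMap, map_smul, hzero]
    funext i
    fin_cases i <;> simp [chshCoordinates, hC', stateHat_unit_unit]
  -- The last outcome plays the role of the closing measurement: `tr(R_{ks} R_k)` is the loop
  -- pairing of the chain `ks` with `φ_k`.
  · obtain ⟨ks, k, rfl⟩ := List.eq_nil_or_concat' ks |>.resolve_left hks
    have := hc ks k
    simpa [loopPairing, chain, iteratedMap, teleportMap, LinearMap.comp_assoc,
      Module.End.mul_eq_comp] using this

theorem three_le_finrank_vectorSpan [FiniteDimensional ℝ V] (hI : I.Stable)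
    (hG : G.LocallyTomographic) (hc : I.DescribesClosedChains) :
    3 ≤ Module.finrank ℝ (vectorSpan ℝ (G.imageOfLocalStates I.teleportationSemigroup)) := by
  have h1 := hI.four_le_finrank hG hc
  have h2 := finrank_span_le_finrank_vectorSpan
    (G.imageOfLocalStates (I.teleportationSemigroup : Set (Module.End ℝ (Module.Dual ℝ V))))
  omega

theorem teleportationSemigroup_le : I.teleportationSemigroup ≤ G.teleportationSemigroup := by
  refine Subsemigroup.closure_mono ?_
  rintro _ ⟨k, rfl⟩
  exact ⟨I.ρ, I.ρ_mem, I.φ k, I.φ_mem k, rfl⟩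

theorem semigroup_mem_localStateCone {T : Module.End ℝ (Module.Dual ℝ V)}
    (hT : T ∈ I.teleportationSemigroup) {σ : Module.Dual ℝ V} (hσ : σ ∈ G.localStateCone) :
    T σ ∈ G.localStateCone := by
  induction hT using Subsemigroup.closure_induction generalizing σ with
  | mem T hT =>
    obtain ⟨k, rfl⟩ := hT
    exact teleport_mem_localStateCone I.ρ_mem.1 (I.φ_mem k).1 hσ
  | mul S T _ _ hS hT => exact hS (hT hσ)

theorem Stable.four_le_localDim [FiniteDimensional ℝ V] (hI : I.Stable)
    (hG : G.LocallyTomographic) (hc : I.DescribesClosedChains) : 4 ≤ G.localDim := by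
  refine (hI.four_le_finrank hG hc).trans
    ((Submodule.finrank_mono (Submodule.span_le.2 ?_)).trans finrank_span_localStateCone)
  rintro _ ⟨T, hT, σ, hσ, -, rfl⟩
  exact Submodule.smul_mem _ _ (Submodule.subset_span
    (semigroup_mem_localStateCone hT (mem_localStates_iff.1 hσ).1))

/-- For a product effect `e ⊗ f` the loop opens: the pairing with `B` is `B(f)(e)`, the value of a
subnormalised state on an effect. Conical combinations preserve the sign. -/
theorem describesClosedChains_of_hasMaximalComposites [FiniteDimensional ℝ V]
    (hG : G.HasMaximalComposites) : I.DescribesClosedChains := by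
  intro ks k
  have hφ := (I.φ_mem k).1
  rw [hG.1 2] at hφ
  generalize I.φ k = φ at hφ
  simp only [loopPairing, ← effectHatLinear_apply]
  induction hφ using Submodule.span_induction with
  | mem x hx =>
    obtain ⟨v, hv, rfl⟩ := hx
    have hB : I.chain ks ∘ₗ effectHatLinear V (PiTensorProduct.tprod ℝ v) =
        LinearMap.smulRight (Module.Dual.eval ℝ V (v 0)) (I.chain ks (v 1)) := by
      refine LinearMap.ext fun σ => ?_
      simp [effectHat_tprod]
    rw [hB, LinearMap.trace_smulRight]
    exact localState_nonneg (chain_mem (hv 1) ks) (hv 0)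
  | zero => rw [map_zero, LinearMap.comp_zero, map_zero]
  | add x y _ _ hx hy =>
    rw [map_add, LinearMap.comp_add, map_add]
    exact add_nonneg hx hy
  | smul c x _ hx =>
    have : I.chain ks ∘ₗ effectHatLinear V (c • x) =
        (c : ℝ) • (I.chain ks ∘ₗ effectHatLinear V x) := by
      rw [← LinearMap.comp_smul, ← map_smul]
      rfl
    rw [this, map_smul, smul_eq_mul]
    exact mul_nonneg c.2 hx

end IteratedCHSH

theorem IsRegularPolygonTheory.localDim_le {V : Type*} [AddCommGroup V] [Module ℝ V] {G : GPT V}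
    {m : ℕ} (hG : G.IsRegularPolygonTheory m) : G.localDim ≤ 3 := by
  obtain ⟨-, J, -, -, hJ, -⟩ := hG
  have hle : Submodule.span ℝ G.localEffectCone ≤ LinearMap.range J := by
    rw [hJ]
    refine Submodule.span_le.2 ?_
    rintro _ ⟨x, -, rfl⟩
    exact ⟨x, rfl⟩
  exact (Submodule.finrank_mono hle).trans (by simpa using LinearMap.finrank_range_le J)

end GPT

/-! ### The no-pancake theorem -/

theorem mainTheorem5 {V : Type*} [AddCommGroup V] [Module ℝ V] [FiniteDimensional ℝ V]
    (G : GPT V) :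
    (G.LocallyTomographic → ∀ (n : ℕ) (I : G.IteratedCHSH n), I.DescribesClosedChains → I.Stable →
      3 ≤ Module.finrank ℝ (vectorSpan ℝ (G.imageOfLocalStates I.teleportationSemigroup)) ∧
      3 ≤ Module.finrank ℝ (vectorSpan ℝ (G.imageOfLocalStates G.teleportationSemigroup))) ∧
    (G.LocallyTomographic → G.localDim ≤ 3 →
      ¬ ∃ (n : ℕ) (I : G.IteratedCHSH n), I.DescribesClosedChains ∧ I.Stable) ∧
    (∀ m : ℕ, G.IsRegularPolygonTheory m → G.LocallyTomographic →
      ¬ ∃ (n : ℕ) (I : G.IteratedCHSH n), I.DescribesClosedChains ∧ I.Stable) ∧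
    (∀ m : ℕ, G.IsRegularPolygonTheory m → G.HasMaximalComposites →
      ¬ ∃ (n : ℕ) (I : G.IteratedCHSH n), I.Stable) ∧
    (G.IsBoxworld → ¬ ∃ (n : ℕ) (I : G.IteratedCHSH n), I.Stable) := by
  have no_stable : G.LocallyTomographic → G.localDim ≤ 3 →
      ¬ ∃ (n : ℕ) (I : G.IteratedCHSH n), I.DescribesClosedChains ∧ I.Stable := by
    rintro hG hd ⟨n, I, hc, hI⟩
    exact absurd (hI.four_le_localDim hG hc) (by omega)
  have no_stable_maximal : ∀ m : ℕ, G.IsRegularPolygonTheory m → G.HasMaximalComposites →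
      ¬ ∃ (n : ℕ) (I : G.IteratedCHSH n), I.Stable := by
    rintro m hm hG ⟨n, I, hI⟩
    exact no_stable hG.locallyTomographic hm.localDim_le
      ⟨n, I, GPT.IteratedCHSH.describesClosedChains_of_hasMaximalComposites hG, hI⟩
  refine ⟨fun hG n I hc hI => ?_, no_stable, fun m hm hG => no_stable hG hm.localDim_le,
    no_stable_maximal, fun hG => no_stable_maximal 4 hG.1 hG.2⟩
  have h := GPT.IteratedCHSH.three_le_finrank_vectorSpan hI hG hc
  refine ⟨h, h.trans (Submodule.finrank_mono (vectorSpan_mono ℝ ?_))⟩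
  rintro _ ⟨T, hT, σ, hσ⟩
  exact ⟨T, GPT.IteratedCHSH.teleportationSemigroup_le hT, σ, hσ⟩
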